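/- Let $k$ be an algebraically closed field of characteristic $0$ and let $a,b\ge 1$ be integers. On the polynomial ring $B=k[x_1,x_2,x_3,y_1,y_2,y_3,v]$ consider the $k$-linear derivation $$D=x_1^a\frac{\partial}{\partial y_1}+x_2^a\frac{\partial}{\partial y_2}+x_3^a\frac{\partial}{\partial y_3}+(y_1y_2y_3)^b\frac{\partial}{\partial v},$$ and let $B^D=\{f\in B: D(f)=0\}$. Then $D$ is locally nilpotent, and $$B^D\subseteq k\oplus (x_1,x_2,x_3)B .$$ Moreover, put $\theta(f)=\sum_{n\ge 0}\frac{D^n(f)}{n!}T^n\in B[T]$ for $f\in B$. Then the elements $$h_i=x_i^{(2b+1)a}\,\theta(v)\big|_{T=-y_i/x_i^a}\qquad(i=1,2,3)$$ of the field of fractions of $B$ lie in $B$, and the algebra $$A=k[x_1,x_2,x_3,\;x_1^ay_2-x_2^ay_1,\;x_1^ay_3-x_3^ay_1,\;x_2^ay_3-x_3^ay_2,\;h_1,h_2,h_3]$$ has the following properties. (1) $A$ is a separating algebra: $A\subseteq B^D$, and whenever two points $p,q\in k^7$ satisfy $f(p)\ne f(q)$ for some $f\in B^D$, there is $g\in A$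 with $g(p)\neq g(q)$. (2) $B^D$ is the ring of regular functions on the quasi-affine variety $\mathrm{Spec}(A)\setminus\mathcal V(x_1,x_2,x_3)$ (by an isomorphism that takes each element of $A$ to the regular function it defines). That is, with $I=(x_1,x_2,x_3)A$ and $Q(A)$ the field of fractions of $A$, $$B^D=\{q\in Q(A): qI^r\subseteq A\text{ for some } r\ge 1\}.$$ -/

import Mathlib

noncomputable section

namespace SevenDim

/-- The seven variables `x₁, x₂, x₃, y₁, y₂, y₃, v`. -/
abbrev Vars : Type := Fin 3 ⊕ Fin 3 ⊕ Unit

/-- The polynomial ring `B = k[x₁, x₂, x₃, y₁, y₂, y₃, v]`. -/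
abbrev B (k : Type*) [Field k] : Type _ := MvPolynomial Vars k

/-- The variable `xᵢ`. -/
def x (k : Type*) [Field k] (i : Fin 3) : B k := MvPolynomial.X (Sum.inl i)

/-- The variable `yᵢ`. -/
def y (k : Type*) [Field k] (i : Fin 3) : B k := MvPolynomial.X (Sum.inr (Sum.inl i))

/-- The variable `v`. -/
def v (k : Type*) [Field k] : B k := MvPolynomial.X (Sum.inr (Sum.inr ()))

/-- The derivation `D = ∑ xᵢ^a ∂/∂yᵢ + (y₁y₂y₃)^b ∂/∂v`. -/
def D (k : Type*) [Field k] (a b : ℕ) : Derivation k (B k) (B k) :=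
  (∑ i : Fin 3, x k i ^ a • MvPolynomial.pderiv (Sum.inr (Sum.inl i))) +
    (y k 0 * y k 1 * y k 2) ^ b • MvPolynomial.pderiv (Sum.inr (Sum.inr ()))

end SevenDim

/-- A derivation is locally nilpotent if each element is killed by some iterate of it. -/
def IsLND {k S : Type*} [Field k] [CommRing S] [Algebra k S] (D : Derivation k S S) : Prop :=
  ∀ f : S, ∃ m : ℕ, D^[m] f = 0

/-- The kernel `S^D` of a derivation `D` of `S`, as a subalgebra of `S`. -/
def Derivation.kernel {k S : Type*} [Field k] [CommRing S] [Algebra k S]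
    (D : Derivation k S S) : Subalgebra k S where
  carrier := {f | D f = 0}
  mul_mem' := by
    intro f g hf hg
    simp only [Set.mem_ofPred_eq] at hf hg ⊢
    simp [hf, hg]
  add_mem' := by
    intro f g hf hg
    simp only [Set.mem_ofPred_eq] at hf hg ⊢
    simp [hf, hg]
  algebraMap_mem' := by
    intro r
    simp

/-- The map `θ : S → S[T]`, `θ(f) = ∑ₖ (Dᵏ(f) / k!) Tᵏ`, describing the action of the additive
group that corresponds to `D`. The sum has finitely many nonzero terms when `D` is locally
nilpotent. -/
def Derivation.theta {k S : Type*} [Field k] [CommRing S] [Algebra k S]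
    (D : Derivation k S S) (f : S) : Polynomial S :=
  ∑ᶠ n : ℕ, Polynomial.monomial n ((Nat.factorial n : k)⁻¹ • D^[n] f)

/-- `A` is a separating algebra for a subalgebra `C` of the ring of polynomial functions on the
affine space `σ → k`: it is contained in `C`, and any two points that are separated by an element
of `C` are separated by an element of `A`. -/
def IsSeparatingAlgebra {k σ : Type*} [Field k] (A C : Subalgebra k (MvPolynomial σ k)) : Prop :=
  A ≤ C ∧ ∀ p q : σ → k, (∃ f ∈ C, MvPolynomial.eval p f ≠ MvPolynomial.eval q f) →
    ∃ g ∈ A, MvPolynomial.eval p g ≠ MvPolynomial.eval q g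

/-- The open subset `Spec(R) \ V(I)` of `Spec(R)`. -/
def specDiff {R : Type*} [CommRing R] (I : Ideal R) :
    (AlgebraicGeometry.Spec (CommRingCat.of R)).Opens :=
  ⟨(PrimeSpectrum.zeroLocus (I : Set R))ᶜ, (PrimeSpectrum.isClosed_zeroLocus _).isOpen_compl⟩

open AlgebraicGeometry CategoryTheory in
/-- The algebra `C`, which contains `A`, is the ring of regular functions on the quasi-affine
scheme `Spec(A) \ V(I)`, by an isomorphism that takes each element of `A` to the regular function
which it defines. -/
def IsRingOfRegularFunctions {k S : Type*} [Field k] [CommRing S] [Algebra k S]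
    (A C : Subalgebra k S) (I : Ideal A) : Prop :=
  ∃ (hA : A ≤ C) (e : C ≃+* Γ(Spec (CommRingCat.of A), specDiff I)),
    ∀ c : A, e (Subalgebra.inclusion hA c) =
      ((Scheme.ΓSpecIso (CommRingCat.of A)).inv ≫
        (Spec (CommRingCat.of A)).presheaf.map
          (homOfLE (le_top : specDiff I ≤ ⊤)).op).hom c

/-- The set `(A : I^∞)_{Q(A)}` for an ideal `I` of a subalgebra `A` of a domain `S`, where the field
of fractions `Q(A)` is taken inside the field of fractions of `S`: the elements `q` of `Q(A)` such
that `q I^r ⊆ A` for some `r ≥ 1`. -/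
def idealTransform {k S : Type*} [Field k] [CommRing S] [IsDomain S] [Algebra k S]
    (A : Subalgebra k S) (I : Ideal A) : Set (FractionRing S) :=
  {q | q ∈ Subfield.closure (algebraMap S (FractionRing S) '' (A : Set S)) ∧
    ∃ r : ℕ, 1 ≤ r ∧ ∀ g ∈ I ^ r, ∃ c ∈ A,
      q * algebraMap S (FractionRing S) (g : S) = algebraMap S (FractionRing S) c}

namespace SevenDim

/-- The ideal `(x₁, x₂, x₃)B`. -/
def xIdeal (k : Type*) [Field k] : Ideal (B k) := Ideal.span (Set.range (x k))

/-- The element `xᵢ^((2b+1)a) θ(v)|_{T = -yᵢ/xᵢ^a}` of the field of fractions of `B`. -/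
def hFrac (k : Type*) [Field k] (a b : ℕ) (i : Fin 3) : FractionRing (B k) :=
  algebraMap (B k) (FractionRing (B k)) (x k i) ^ ((2 * b + 1) * a) *
    Polynomial.aeval
      (-(algebraMap (B k) (FractionRing (B k)) (y k i)) /
        algebraMap (B k) (FractionRing (B k)) (x k i) ^ a)
      ((D k a b).theta (v k))

/-- The algebra generated by `x₁, x₂, x₃`, the three elements `xᵢ^a yⱼ - xⱼ^a yᵢ` with `i < j`, and
three further polynomials `h₁, h₂, h₃`. -/
def A (k : Type*) [Field k] (a : ℕ) (h : Fin 3 → B k) : Subalgebra k (B k) :=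
  Algebra.adjoin k
    {x k 0, x k 1, x k 2,
      x k 0 ^ a * y k 1 - x k 1 ^ a * y k 0,
      x k 0 ^ a * y k 2 - x k 2 ^ a * y k 0,
      x k 1 ^ a * y k 2 - x k 2 ^ a * y k 1,
      h 0, h 1, h 2}

/-- The ideal of `A` generated by `x₁, x₂, x₃`. -/
def xIdealA (k : Type*) [Field k] (a : ℕ) (h : Fin 3 → B k) : Ideal (A k a h) :=
  Ideal.span {g : A k a h | ∃ i, (g : B k) = x k i}

end SevenDim

end

/-!
The exponential of `T D` fixes the `xᵢ`, moves `y` to `y + T x^a`, and adds to `v` the integral of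
`(y₁y₂y₃)^b` along this segment. An invariant is constant on orbits. Let two points of `x = 0` with
the same `v` lie on a line in direction `ω` such that the integral of `(y₁y₂y₃)^b` between them
vanishes. If `ξ ^ a = ω`, their translates to `x = s ξ` lie on one orbit for each `s ≠ 0`, so for
`s → 0` an invariant takes the same value at both points. Each point of `x = 0` is joined in this
way to the plane `y₁ = 0`, because `∫ X ^ (2 * b) * (X - 1) ^ b` has a root other than `0` and `1`,
and points of that plane are joined to `y = 0`; as orbits over `x = 0` are parallel to the `v`-axis
where `y₁y₂y₃ ≠ 0`, invariants are constant on `x = 0`.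

Where `xᵢ ≠ 0` each orbit meets the slice `yᵢ = 0` in one point, whose coordinates lie in
`A[1/xᵢ]`. So `B^D[1/xᵢ] = A[1/xᵢ]`, and `B^D` is the intersection of these rings.
-/

noncomputable section

section Antiderivative

open Polynomial

variable (k : Type*) {R S : Type*} [Field k] [CommRing R] [Algebra k R] [CommRing S] [Algebra k S]

/-- The antiderivative with constant term `0` of a polynomial over a `k`-algebra, where `k` is a
field of characteristic `0`; it serves to write integrals of polynomials. In characteristic `p` the
coefficients that would need division by `p` become `0`. -/
def antiderivative : R[X] →ₗ[R] R[X] := lsum fun n => ((n : k) + 1)⁻¹ • monomial (n + 1)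

theorem antiderivative_apply (p : R[X]) :
    antiderivative k p = p.sum fun n c => monomial (n + 1) (((n : k) + 1)⁻¹ • c) := by
  simp only [antiderivative, lsum, LinearMap.coe_mk, AddHom.coe_mk, LinearMap.smul_apply,
    smul_monomial]

theorem coeff_zero_antiderivative (p : R[X]) : (antiderivative k p).coeff 0 = 0 := by
  simp [antiderivative_apply, sum_def, coeff_monomial]

theorem coeff_succ_antiderivative (p : R[X]) (n : ℕ) :
    (antiderivative k p).coeff (n + 1) = ((n : k) + 1)⁻¹ • p.coeff n := by
  simp +contextual [antiderivative_apply, sum_def, coeff_monomial]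

theorem eval_zero_antiderivative (p : R[X]) : (antiderivative k p).eval 0 = 0 := by
  rw [← coeff_zero_eq_eval_zero, coeff_zero_antiderivative]

theorem map_antiderivative (g : R →ₐ[k] S) (p : R[X]) :
    (antiderivative k p).map (g : R →+* S) = antiderivative k (p.map (g : R →+* S)) := by
  ext n
  cases n with
  | zero => simp [coeff_zero_antiderivative]
  | succ n => simp [coeff_succ_antiderivative]

variable [CharZero k]

theorem derivative_antiderivative (p : R[X]) : derivative (antiderivative k p) = p := by
  ext n
  have hn : (n : k) + 1 ≠ 0 := n.cast_add_one_ne_zero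
  have hcast : (n : R) + 1 = algebraMap k R (n + 1) := by simp
  rw [coeff_derivative, coeff_succ_antiderivative, hcast, mul_comm, ← Algebra.smul_def, smul_smul,
    mul_inv_cancel₀ hn, one_smul]

theorem eq_antiderivative {p q : R[X]} (h₀ : p.eval 0 = 0) (h : derivative p = q) :
    p = antiderivative k q := by
  ext n
  cases n with
  | zero => rw [coeff_zero_antiderivative, coeff_zero_eq_eval_zero, h₀]
  | succ n =>
    have hn : (n : k) + 1 ≠ 0 := n.cast_add_one_ne_zero
    have hcast : (n : R) + 1 = algebraMap k R (n + 1) := by simp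
    rw [coeff_succ_antiderivative, ← h, coeff_derivative, hcast, mul_comm, ← Algebra.smul_def,
      smul_smul, inv_mul_cancel₀ hn, one_smul]

theorem antiderivative_one : antiderivative k (1 : R[X]) = X :=
  (eq_antiderivative k (by simp) (by simp)).symm

theorem C_mul_antiderivative_comp (p : R[X]) (c d : R) :
    C c * antiderivative k (p.comp (C d + C c * X)) =
      (antiderivative k p).comp (C d + C c * X) - C ((antiderivative k p).eval d) := by
  rw [← smul_eq_C_mul, ← map_smul]
  refine (eq_antiderivative k (by simp [eval_comp]) ?_).symm
  simp [derivative_comp, derivative_antiderivative, smul_eq_C_mul]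

theorem antiderivative_ne_zero {p : R[X]} (hp : p ≠ 0) : antiderivative k p ≠ 0 := by
  intro h
  rw [← derivative_antiderivative k p, h, derivative_zero] at hp
  exact hp rfl

variable {K : Type*} [Field K] [Algebra k K]

theorem natDegree_antiderivative {p : K[X]} (hp : p ≠ 0) :
    (antiderivative k p).natDegree = p.natDegree + 1 := by
  have : CharZero K := charZero_of_injective_algebraMap (algebraMap k K).injective
  have hdeg : p.natDegree = (antiderivative k p).natDegree - 1 := by
    rw [← natDegree_derivative, derivative_antiderivative]
  have hpos : (antiderivative k p).natDegree ≠ 0 := by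
    intro h
    rw [← derivative_antiderivative k p, derivative_of_natDegree_zero h] at hp
    exact hp rfl
  omega

theorem count_roots_antiderivative [DecidableEq K] {p : K[X]} (hp : p ≠ 0) {t : K}
    (ht : (antiderivative k p).IsRoot t) :
    (antiderivative k p).roots.count t = p.roots.count t + 1 := by
  have : CharZero K := charZero_of_injective_algebraMap (algebraMap k K).injective
  have hpos := (rootMultiplicity_pos (antiderivative_ne_zero k hp)).2 ht
  have hmult := derivative_rootMultiplicity_of_root ht
  rw [derivative_antiderivative] at hmult
  rw [count_roots, count_roots, hmult]
  omega

/-- Otherwise the only roots of the antiderivative, which has degree `m + n + 1`, would be `0` with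
multiplicity `m + 1` and possibly `1` with multiplicity `n + 1`. -/
theorem exists_isRoot_antiderivative [IsAlgClosed K] (m : ℕ) {n : ℕ} (hn : n ≠ 0) :
    ∃ t : K, t ≠ 0 ∧ t ≠ 1 ∧ (antiderivative k (X ^ m * (X - 1) ^ n : K[X])).IsRoot t := by
  classical
  let p : K[X] := X ^ m * (X - 1) ^ n
  have hp : p ≠ 0 :=
    mul_ne_zero (pow_ne_zero _ X_ne_zero) (pow_ne_zero _ (X_sub_C_ne_zero 1))
  have hroots : p.roots = m • {0} + n • {1} := by
    rw [roots_mul hp, roots_pow, roots_pow, roots_X, ← C_1, roots_X_sub_C]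
  have hdeg : (antiderivative k p).natDegree = m + n + 1 := by
    rw [natDegree_antiderivative k hp, ← IsAlgClosed.card_roots_eq_natDegree, hroots]
    simp
  have hcount_zero : (antiderivative k p).roots.count 0 = m + 1 := by
    rw [count_roots_antiderivative k hp (eval_zero_antiderivative k p), hroots]
    simp
  have hcount_one : (antiderivative k p).roots.count 1 = 0 ∨
      (antiderivative k p).roots.count 1 = n + 1 := by
    by_cases h : (antiderivative k p).IsRoot 1
    · rw [count_roots_antiderivative k hp h, hroots]
      simp
    · exact Or.inl (by rw [count_roots, rootMultiplicity_eq_zero h])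
  by_contra! h
  have hcard : (antiderivative k p).roots.count 0 + (antiderivative k p).roots.count 1 =
      m + n + 1 := by
    rw [← hdeg, ← IsAlgClosed.card_roots_eq_natDegree,
      ← Finset.sum_pair (f := (antiderivative k p).roots.count) zero_ne_one]
    refine Multiset.sum_count_eq_card fun t ht => ?_
    by_contra ht'
    simp only [Finset.mem_insert, Finset.mem_singleton, not_or] at ht'
    exact h t ht'.1 ht'.2 (isRoot_of_mem_roots ht)
  omega

end Antiderivative

section Exponential

open Polynomial

variable {k S R : Type*} [Field k] [CommRing S] [Algebra k S] [CommRing R] [Algebra k R]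

/-- The homomorphism `φ` is the exponential `exp (T D)` of the derivation `D`, that is, the coaction
of the additive group on `S` with infinitesimal generator `D`. It is characterised by a
differential equation in `T` with initial value, so that no infinite sum occurs. -/
structure IsExponential (D : Derivation k S S) (φ : S →ₐ[k] S[X]) : Prop where
  eval_zero_apply (f : S) : (φ f).eval 0 = f
  derivative_apply (f : S) : derivative (φ f) = φ (D f)

theorem IsExponential.of_adjoin_eq_top {D : Derivation k S S} {φ : S →ₐ[k] S[X]} {G : Set S}
    (hG : Algebra.adjoin k G = ⊤) (h₀ : ∀ g ∈ G, (φ g).eval 0 = g)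
    (h : ∀ g ∈ G, derivative (φ g) = φ (D g)) : IsExponential D φ where
  eval_zero_apply f := by
    induction (hG ▸ Algebra.mem_top : f ∈ Algebra.adjoin k G) using Algebra.adjoin_induction with
    | mem g hg => exact h₀ g hg
    | algebraMap c => simp
    | add f g _ _ hf hg => simp [hf, hg]
    | mul f g _ _ hf hg => simp [hf, hg]
  derivative_apply f := by
    induction (hG ▸ Algebra.mem_top : f ∈ Algebra.adjoin k G) using Algebra.adjoin_induction with
    | mem g hg => exact h g hg
    | algebraMap c => simp
    | add f g _ _ hf hg => simp [hf, hg]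
    | mul f g _ _ hf hg =>
      simp only [map_mul, derivative_mul, hf, hg, Derivation.leibniz, smul_eq_mul, map_add]
      ring

namespace IsExponential

variable {D : Derivation k S S} {φ : S →ₐ[k] S[X]} (hφ : IsExponential D φ)

include hφ

theorem iterate_derivative_apply (f : S) (n : ℕ) : derivative^[n] (φ f) = φ (D^[n] f) :=
  (Function.Semiconj.iterate_right (f := φ) (ga := D) (gb := derivative)
    (fun g => (hφ.derivative_apply g).symm) n f).symm

variable [CharZero k]

theorem coeff_apply (f : S) (n : ℕ) : (φ f).coeff n = (n.factorial : k)⁻¹ • D^[n] f := by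
  have hn : (n.factorial : k) ≠ 0 := Nat.cast_ne_zero.2 n.factorial_ne_zero
  rw [← hφ.eval_zero_apply (D^[n] f), ← hφ.iterate_derivative_apply, ← coeff_zero_eq_eval_zero,
    coeff_iterate_derivative, zero_add, Nat.descFactorial_self, ← Nat.cast_smul_eq_nsmul k,
    inv_smul_smul₀ hn]

theorem isLND : IsLND D := by
  intro f
  refine ⟨(φ f).natDegree + 1, ?_⟩
  have hcoeff := hφ.coeff_apply f ((φ f).natDegree + 1)
  rw [coeff_eq_zero_of_natDegree_lt (Nat.lt_succ_self _)] at hcoeff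
  exact (smul_eq_zero.1 hcoeff.symm).resolve_left
    (inv_ne_zero (Nat.cast_ne_zero.2 (Nat.factorial_ne_zero _)))

theorem theta_eq (f : S) : D.theta f = φ f := by
  simp only [Derivation.theta, ← hφ.coeff_apply f]
  rw [finsum_eq_sum_of_support_subset (s := (φ f).support), ← as_sum_support]
  intro n hn
  simpa using hn

theorem mem_kernel_iff {f : S} : f ∈ D.kernel ↔ φ f = C f := by
  constructor
  · intro hf
    have hderiv : derivative (φ f - C f) = 0 := by
      rw [derivative_sub, derivative_C, hφ.derivative_apply, show D f = 0 from hf, map_zero,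
        sub_zero]
    rw [← sub_eq_zero, eq_antiderivative k (by simp [hφ.eval_zero_apply]) hderiv, map_zero]
  · intro hf
    change D f = 0
    rw [← hφ.eval_zero_apply (D f), ← hφ.derivative_apply, hf, derivative_C, eval_zero]

end IsExponential

/-- The translate of the `R`-valued point `P` of `Spec S` along its orbit under the additive group,
by the time `t`. -/
def orbitPoint (φ : S →ₐ[k] S[X]) (P : S →ₐ[k] R) (t : R) : S →ₐ[k] R :=
  (eval₂AlgHom P t fun _ => Commute.all _ _).comp φ

theorem orbitPoint_apply (φ : S →ₐ[k] S[X]) (P : S →ₐ[k] R) (t : R) (f : S) :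
    orbitPoint φ P t f = (φ f).eval₂ (P : S →+* R) t := rfl

theorem IsExponential.orbitPoint_eq [CharZero k] {D : Derivation k S S} {φ : S →ₐ[k] S[X]}
    (hφ : IsExponential D φ) (P : S →ₐ[k] R) (t : R) {f : S} (hf : f ∈ D.kernel) :
    orbitPoint φ P t f = P f := by
  rw [orbitPoint_apply, hφ.mem_kernel_iff.1 hf, eval₂_C, RingHom.coe_coe]

end Exponential

section LocalizationAway

variable {k S : Type*} [Field k] [CommRing S] [Algebra k S]

/-- The localization `A[1/s]` of a subalgebra `A` of `S`, realised in the ring of fractions of `S`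
as the set of all `q` such that `s ^ N * q ∈ A` for some `N`. It is the whole ring if `s = 0`. -/
def localizationAway (A : Subalgebra k S) (s : A) : Subalgebra k (FractionRing S) where
  carrier := {q | ∃ N : ℕ, ∃ c ∈ A,
    algebraMap S (FractionRing S) s ^ N * q = algebraMap S (FractionRing S) c}
  mul_mem' := by
    rintro q r ⟨N, c, hc, hq⟩ ⟨M, d, hd, hr⟩
    exact ⟨N + M, c * d, mul_mem hc hd, by rw [map_mul, ← hq, ← hr]; ring⟩
  add_mem' := by
    rintro q r ⟨N, c, hc, hq⟩ ⟨M, d, hd, hr⟩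
    refine ⟨N + M, s ^ M * c + s ^ N * d,
      add_mem (mul_mem (pow_mem s.2 M) hc) (mul_mem (pow_mem s.2 N) hd), ?_⟩
    rw [map_add, map_mul, map_mul, map_pow, map_pow, ← hq, ← hr]
    ring
  algebraMap_mem' c := ⟨0, algebraMap k S c, A.algebraMap_mem c, by
    rw [pow_zero, one_mul, ← IsScalarTower.algebraMap_apply]⟩

theorem algebraMap_mem_localizationAway_iff {A : Subalgebra k S} {s : A} {f : S} :
    algebraMap S (FractionRing S) f ∈ localizationAway A s ↔ ∃ N : ℕ, (s : S) ^ N * f ∈ A := by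
  refine exists_congr fun N => ⟨?_, fun h => ⟨_, h, by rw [map_mul, map_pow]⟩⟩
  rintro ⟨c, hc, h⟩
  rw [← map_pow, ← map_mul] at h
  rwa [IsFractionRing.injective S (FractionRing S) h]

/-- The ideal of all `g ∈ A` such that `q * g ∈ A`, for an element `q` of the ring of fractions
of `S ⊇ A`; it describes the condition on `q` in `idealTransform`. -/
def denominatorIdeal (A : Subalgebra k S) (q : FractionRing S) : Ideal A where
  carrier := {g | ∃ c ∈ A, q * algebraMap S (FractionRing S) g = algebraMap S (FractionRing S) c}
  zero_mem' := ⟨0, A.zero_mem, by simp⟩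
  add_mem' := by
    rintro f g ⟨c, hc, hf⟩ ⟨d, hd, hg⟩
    exact ⟨c + d, add_mem hc hd, by simp [mul_add, hf, hg]⟩
  smul_mem' := by
    rintro f g ⟨c, hc, hg⟩
    exact ⟨f * c, mul_mem f.2 hc, by simp [← hg, mul_left_comm]⟩

theorem mem_localizationAway_iff_exists_pow_mem {A : Subalgebra k S} {s : A}
    {q : FractionRing S} :
    q ∈ localizationAway A s ↔ ∃ N : ℕ, s ^ N ∈ denominatorIdeal A q := by
  refine exists_congr fun N => exists_congr fun c => and_congr_right fun _ => ?_
  rw [SubmonoidClass.coe_pow, map_pow, mul_comm]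

variable [IsDomain S]

theorem mem_range_algebraMap_of_mem_localizationAway {A : Subalgebra k S} {s r : A}
    (hs : Prime (s : S)) (hsr : ¬ (s : S) ∣ r) {q : FractionRing S}
    (hqs : q ∈ localizationAway A s) (hqr : q ∈ localizationAway A r) :
    q ∈ (algebraMap S (FractionRing S)).range := by
  obtain ⟨N, c, -, hc⟩ := hqs
  obtain ⟨M, d, -, hd⟩ := hqr
  have hcd : (r : S) ^ M * c = s ^ N * d := by
    apply IsFractionRing.injective S (FractionRing S)
    rw [map_mul, map_mul, map_pow, map_pow, ← hc, ← hd]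
    ring
  obtain ⟨e, rfl⟩ : (s : S) ^ N ∣ c :=
    hs.pow_dvd_of_dvd_mul_left N (fun h => hsr (hs.dvd_of_dvd_pow h)) ⟨d, hcd⟩
  rw [map_mul, map_pow] at hc
  refine ⟨e, (mul_left_cancel₀ (pow_ne_zero N ?_) hc).symm⟩
  exact (map_ne_zero_iff _ (IsFractionRing.injective S (FractionRing S))).2 hs.ne_zero

theorem mem_closure_of_mem_localizationAway {A : Subalgebra k S} {s : A} (hs : s ≠ 0)
    {q : FractionRing S} (hq : q ∈ localizationAway A s) :
    q ∈ Subfield.closure (algebraMap S (FractionRing S) '' (A : Set S)) := by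
  obtain ⟨N, c, hc, h⟩ := hq
  have hs' : algebraMap S (FractionRing S) s ≠ 0 :=
    (map_ne_zero_iff _ (IsFractionRing.injective S (FractionRing S))).2 (by simpa using hs)
  rw [eq_div_of_mul_eq (pow_ne_zero N hs') ((mul_comm _ _).trans h)]
  exact div_mem (Subfield.subset_closure (Set.mem_image_of_mem _ hc))
    (pow_mem (Subfield.subset_closure (Set.mem_image_of_mem _ s.2)) N)

theorem coe_iInf_localizationAway (A : Subalgebra k S) {ι : Type*} [Finite ι] [Nonempty ι]
    {s : ι → A} (hs : ∀ i, s i ≠ 0) :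
    ((⨅ i, localizationAway A (s i) : Subalgebra k (FractionRing S)) : Set (FractionRing S)) =
      idealTransform A (Ideal.span (Set.range s)) := by
  ext q
  rw [SetLike.mem_coe, Algebra.mem_iInf]
  constructor
  · intro hq
    have hrad : Ideal.span (Set.range s) ≤ (denominatorIdeal A q).radical := by
      rw [Ideal.span_le]
      rintro _ ⟨i, rfl⟩
      exact mem_localizationAway_iff_exists_pow_mem.1 (hq i)
    obtain ⟨r, hr⟩ := Ideal.exists_pow_le_of_le_radical_of_fg hrad
      (Submodule.fg_span (Set.finite_range s))
    exact ⟨mem_closure_of_mem_localizationAway (hs (Classical.arbitrary ι)) (hq _), r + 1,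
      r.succ_pos, fun g hg => hr (Ideal.pow_le_pow_right r.le_succ hg)⟩
  · rintro ⟨-, r, -, hr⟩ i
    exact mem_localizationAway_iff_exists_pow_mem.2
      ⟨r, hr _ (Ideal.pow_mem_pow (Ideal.subset_span (Set.mem_range_self i)) r)⟩

end LocalizationAway

/-- Off the common zero set of the `s i` the values of `f ∈ C` are determined by those of `A`, and
on it `f` is constant. -/
theorem isSeparatingAlgebra_of_pow_mul_mem {k σ ι : Type*} [Field k]
    {A C : Subalgebra k (MvPolynomial σ k)} {s : ι → MvPolynomial σ k} (hAC : A ≤ C)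
    (hs : ∀ i, s i ∈ A) (hmul : ∀ f ∈ C, ∀ i, ∃ N : ℕ, s i ^ N * f ∈ A)
    (hC : Subalgebra.toSubmodule C ≤ 1 ⊔ (Ideal.span (Set.range s)).restrictScalars k) :
    IsSeparatingAlgebra A C := by
  refine ⟨hAC, ?_⟩
  rintro p q ⟨f, hf, hne⟩
  by_contra! hA
  refine hne ?_
  by_cases hp : ∃ i, MvPolynomial.eval p (s i) ≠ 0
  · obtain ⟨i, hi⟩ := hp
    obtain ⟨N, hN⟩ := hmul f hf i
    have h := hA _ hN
    rw [map_mul, map_mul, map_pow, map_pow, ← hA _ (hs i)] at h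
    exact mul_left_cancel₀ (pow_ne_zero N hi) h
  · push Not at hp
    have hker (r : σ → k) (hr : ∀ i, MvPolynomial.eval r (s i) = 0) :
        Ideal.span (Set.range s) ≤ RingHom.ker (MvPolynomial.eval r) := by
      rw [Ideal.span_le]
      rintro _ ⟨i, rfl⟩
      exact hr i
    obtain ⟨c, hc, g, hg, rfl⟩ := Submodule.mem_sup.1 (hC hf)
    obtain ⟨c, rfl⟩ := Submodule.mem_one.1 hc
    rw [MvPolynomial.algebraMap_eq, map_add, map_add, MvPolynomial.eval_C, MvPolynomial.eval_C,
      RingHom.mem_ker.1 (hker p hp hg),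
      RingHom.mem_ker.1 (hker q (fun i => hA _ (hs i) ▸ hp i) hg)]

section RegularFunctions

open AlgebraicGeometry CategoryTheory

theorem germToFunctionField_map {X : Scheme} [IsIntegral X] {V W : X.Opens} [Nonempty V]
    [Nonempty W] (h : W ≤ V) (t : Γ(X, V)) :
    X.germToFunctionField W (X.presheaf.map (homOfLE h).op t) = X.germToFunctionField V t :=
  X.presheaf.germ_res_apply (homOfLE h) _ _ t

theorem range_germToFunctionField_iSup {X : Scheme} [IsIntegral X] {ι : Type*} [Nonempty ι]
    {V : ι → X.Opens} [∀ i, Nonempty (V i)] [Nonempty (⨆ i, V i : X.Opens)] :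
    (X.germToFunctionField (⨆ i, V i)).hom.range =
      ⨅ i, (X.germToFunctionField (V i)).hom.range := by
  ext q
  rw [Subring.mem_iInf]
  constructor
  · rintro ⟨t, rfl⟩ i
    exact ⟨X.presheaf.map (homOfLE (le_iSup V i)).op t, germToFunctionField_map (le_iSup V i) t⟩
  · intro h
    choose t ht using h
    have hcompatible : TopCat.Presheaf.IsCompatible X.presheaf V t := by
      intro i j
      have hgen (i : ι) : genericPoint X ∈ V i :=
        ((genericPoint_spec X).mem_open_set_iff (V i).isOpen).2
          (by simpa using (inferInstance : Nonempty (V i)))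
      have : Nonempty (V i ⊓ V j : X.Opens) := ⟨⟨genericPoint X, hgen i, hgen j⟩⟩
      apply X.germToFunctionField_injective (V i ⊓ V j)
      refine (germToFunctionField_map inf_le_left (t i)).trans ?_
      refine Eq.trans ?_ (germToFunctionField_map inf_le_right (t j)).symm
      exact (ht i).trans (ht j).symm
    obtain ⟨g, hg, -⟩ := X.sheaf.existsUnique_gluing' V (⨆ i, V i)
      (fun i => homOfLE (le_iSup V i)) le_rfl t hcompatible
    let i := Classical.arbitrary ι
    refine ⟨g, ?_⟩
    rw [← ht i, ← hg i]
    exact (germToFunctionField_map (le_iSup V i) g).symm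

section Affine

variable {R : CommRingCat} [IsDomain R]

theorem germToFunctionField_algebraMap (V : (Spec R).Opens) [Nonempty V] (r : R) :
    (Spec R).germToFunctionField V (algebraMap R Γ(Spec R, V) r) =
      algebraMap R (Spec R).functionField r :=
  StructureSheaf.algebraMap_germ_apply V _ _ r

theorem mem_range_comp_germToFunctionField_iff {K : Type*} [Field K]
    (κ : (Spec R).functionField →+* K) {s : R} (hs : s ≠ 0) (V : (Spec R).Opens) [Nonempty V]
    [IsLocalization.Away s Γ(Spec R, V)] {q : K} :
    q ∈ (κ.comp ((Spec R).germToFunctionField V).hom).range ↔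
      ∃ (N : ℕ) (r : R), κ (algebraMap R (Spec R).functionField s) ^ N * q =
        κ (algebraMap R (Spec R).functionField r) := by
  simp only [← germToFunctionField_algebraMap V]
  constructor
  · rintro ⟨t, rfl⟩
    obtain ⟨N, r, hr⟩ := IsLocalization.Away.surj s t
    refine ⟨N, r, ?_⟩
    rw [← hr, map_mul, map_mul, map_pow, map_pow, mul_comm]
    rfl
  · rintro ⟨N, r, h⟩
    have hne : κ ((Spec R).germToFunctionField V (algebraMap R Γ(Spec R, V) s)) ^ N ≠ 0 := by
      rw [germToFunctionField_algebraMap]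
      exact pow_ne_zero N ((map_ne_zero κ).2
        ((map_ne_zero_iff _ (IsFractionRing.injective R _)).2 hs))
    refine ⟨IsLocalization.mk' _ r (⟨s ^ N, N, rfl⟩ : Submonoid.powers s),
      mul_left_cancel₀ hne (Eq.trans ?_ h.symm)⟩
    rw [← IsLocalization.mk'_spec' Γ(Spec R, V) r (⟨s ^ N, N, rfl⟩ : Submonoid.powers s)]
    rw [map_mul, map_mul, map_pow, map_pow, map_pow]
    rfl

end Affine

theorem exists_ringEquiv_of_range_eq {R S K : Type*} [CommRing R] [CommRing S] [CommRing K]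
    {φ : R →+* K} {ψ : S →+* K} (hφ : Function.Injective φ) (hψ : Function.Injective ψ)
    (h : φ.range = ψ.range) : ∃ e : R ≃+* S, ∀ r, ψ (e r) = φ r := by
  let eφ := RingEquiv.ofBijective φ.rangeRestrict
    ⟨fun _ _ h' => hφ (congrArg Subtype.val h'), φ.rangeRestrict_surjective⟩
  let eψ := RingEquiv.ofBijective ψ.rangeRestrict
    ⟨fun _ _ h' => hψ (congrArg Subtype.val h'), ψ.rangeRestrict_surjective⟩
  refine ⟨(eφ.trans (RingEquiv.subringCongr h)).trans eψ.symm, fun r => ?_⟩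
  exact congrArg Subtype.val (eψ.apply_symm_apply (RingEquiv.subringCongr h (eφ r)))

/-- The open subset `s ≠ 0` of `Spec R`: the set `PrimeSpectrum.basicOpen s`, regarded as an open
subset of the scheme. -/
def specBasicOpen {R : CommRingCat} (s : R) : (Spec R).Opens := PrimeSpectrum.basicOpen s

instance {R : CommRingCat} (s : R) : IsLocalization.Away s Γ(Spec R, specBasicOpen s) :=
  StructureSheaf.IsLocalization.to_basicOpen R s

theorem nonempty_specBasicOpen {R : CommRingCat} [IsDomain R] {s : R} (hs : s ≠ 0) :
    Nonempty (specBasicOpen s) :=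
  ⟨⟨(⊥ : PrimeSpectrum R), hs⟩⟩

theorem specDiff_span_range {R : CommRingCat} {ι : Type*} (s : ι → R) :
    specDiff (Ideal.span (Set.range s)) = ⨆ i, specBasicOpen (s i) := by
  have hmem (p : PrimeSpectrum R) :
      ¬ Set.range s ⊆ p.asIdeal ↔ ∃ i, p ∈ PrimeSpectrum.basicOpen (s i) := by
    rw [Set.range_subset_iff, not_forall]
    rfl
  ext p
  refine Iff.trans (not_congr ?_) ((hmem p).trans TopologicalSpace.Opens.mem_iSup.symm)
  exact Ideal.span_le

/-- Let `R` be embedded in a field `K`. The regular functions on the union of the open subsets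
`s i ≠ 0` of `Spec R` are identified with the `q ∈ K` that lie in every `R[1/s i]`. -/
theorem exists_ringHom_regularFunctions {R : CommRingCat} [IsDomain R] {K : Type*} [Field K]
    {φ : R →+* K} (hφ : Function.Injective φ) {ι : Type*} [Nonempty ι] {s : ι → R}
    (hs : ∀ i, s i ≠ 0) :
    ∃ ψ : Γ(Spec R, specDiff (Ideal.span (Set.range s))) →+* K,
      Function.Injective ψ ∧ (∀ c : R, ψ (algebraMap R _ c) = φ c) ∧
      ∀ q, q ∈ ψ.range ↔ ∀ i, ∃ (N : ℕ) (c : R), φ (s i) ^ N * q = φ c := by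
  rw [specDiff_span_range]
  have hV (i : ι) : Nonempty (specBasicOpen (s i)) := nonempty_specBasicOpen (hs i)
  have hiSup : Nonempty (⨆ i, specBasicOpen (s i) : (Spec R).Opens) :=
    (hV (Classical.arbitrary ι)).map (Set.inclusion (le_iSup (fun i => specBasicOpen (s i)) _))
  let κ : (Spec R).functionField →+* K := IsFractionRing.lift hφ
  have hκ (c : R) : κ (algebraMap R _ c) = φ c := IsFractionRing.lift_algebraMap hφ c
  refine ⟨κ.comp ((Spec R).germToFunctionField (⨆ i, specBasicOpen (s i))).hom,
    κ.injective.comp ((Spec R).germToFunctionField_injective _), fun c => ?_, fun q => ?_⟩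
  · rw [← hκ c, ← germToFunctionField_algebraMap (⨆ i, specBasicOpen (s i)) c]
    rfl
  · rw [← RingHom.map_range, range_germToFunctionField_iSup, Subring.map_iInf _ κ.injective,
      Subring.mem_iInf]
    refine forall_congr' fun i => ?_
    rw [RingHom.map_range, mem_range_comp_germToFunctionField_iff κ (hs i)]
    simp only [hκ]

/-- Both rings are identified with the same subring of the field of fractions of `S`. -/
theorem isRingOfRegularFunctions_of_map_eq_iInf {k S : Type*} [Field k] [CommRing S] [IsDomain S]
    [Algebra k S] {A C : Subalgebra k S} (hAC : A ≤ C) {ι : Type*} [Nonempty ι] {s : ι → A}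
    (hs : ∀ i, s i ≠ 0)
    (hC : C.map (IsScalarTower.toAlgHom k S (FractionRing S)) = ⨅ i, localizationAway A (s i)) :
    IsRingOfRegularFunctions A C (Ideal.span (Set.range s)) := by
  have hinj := IsFractionRing.injective S (FractionRing S)
  have : IsDomain (CommRingCat.of A) := inferInstanceAs (IsDomain A)
  obtain ⟨ψ, hψ, hψA, hψr⟩ := exists_ringHom_regularFunctions (R := CommRingCat.of A)
    (φ := (algebraMap S (FractionRing S)).comp A.val.toRingHom)
    (hinj.comp Subtype.val_injective) hs
  let φ : C →+* FractionRing S := (algebraMap S (FractionRing S)).comp C.val.toRingHom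
  have hφ : Function.Injective φ := hinj.comp Subtype.val_injective
  have hrange : φ.range = ψ.range := by
    ext q
    have hmem : q ∈ C.map (IsScalarTower.toAlgHom k S (FractionRing S)) ↔
        ∀ i, q ∈ localizationAway A (s i) := by rw [hC, Algebra.mem_iInf]
    rw [hψr]
    refine (Iff.trans ?_ hmem).trans (forall_congr' fun i => exists_congr fun N => ?_)
    · exact ⟨fun ⟨f, hf⟩ => ⟨f, f.2, hf⟩, fun ⟨f, hf, h⟩ => ⟨⟨f, hf⟩, h⟩⟩
    · exact ⟨fun ⟨c, hc, h⟩ => ⟨⟨c, hc⟩, h⟩, fun ⟨c, h⟩ => ⟨c, c.2, h⟩⟩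
  obtain ⟨e, he⟩ := exists_ringEquiv_of_range_eq hφ hψ hrange
  exact ⟨hAC, e, fun c => hψ ((he _).trans (hψA c).symm)⟩

end RegularFunctions

namespace SevenDim

open Polynomial

section Points

variable {k R S : Type*} [Field k] [CommRing R] [Algebra k R] [CommRing S] [Algebra k S]

theorem D_x (a b : ℕ) (i : Fin 3) : D k a b (x k i) = 0 := by
  simp [D, x, MvPolynomial.pderiv_X, Fin.sum_univ_three]

theorem D_y (a b : ℕ) (i : Fin 3) : D k a b (y k i) = x k i ^ a := by
  fin_cases i <;> simp [D, y, MvPolynomial.pderiv_X, Fin.sum_univ_three]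

theorem D_v (a b : ℕ) : D k a b (v k) = (∏ j, y k j) ^ b := by
  simp [D, v, MvPolynomial.pderiv_X, Fin.sum_univ_three, Fin.prod_univ_three]

/-- The `R`-valued point of affine space with the given coordinates, as the evaluation at it. -/
def point (ξ η : Fin 3 → R) (ν : R) : B k →ₐ[k] R :=
  MvPolynomial.aeval (Sum.elim ξ (Sum.elim η fun _ => ν))

@[simp] theorem point_x (ξ η : Fin 3 → R) (ν : R) (i : Fin 3) : point ξ η ν (x k i) = ξ i := by
  simp [point, x]

@[simp] theorem point_y (ξ η : Fin 3 → R) (ν : R) (i : Fin 3) : point ξ η ν (y k i) = η i := by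
  simp [point, y]

@[simp] theorem point_v (ξ η : Fin 3 → R) (ν : R) : point ξ η ν (v k) = ν := by
  simp [point, v]

theorem adjoin_eq_top : Algebra.adjoin k (Set.range (x k) ∪ Set.range (y k) ∪ {v k}) = ⊤ := by
  rw [eq_top_iff, ← MvPolynomial.adjoin_range_X]
  refine Algebra.adjoin_mono ?_
  rintro _ ⟨i | i | i, rfl⟩
  · exact Or.inl (Or.inl ⟨i, rfl⟩)
  · exact Or.inl (Or.inr ⟨i, rfl⟩)
  · exact Or.inr rfl

theorem algHom_ext {P Q : B k →ₐ[k] R} (hx : ∀ i, P (x k i) = Q (x k i))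
    (hy : ∀ i, P (y k i) = Q (y k i)) (hv : P (v k) = Q (v k)) : P = Q := by
  refine AlgHom.ext_of_adjoin_eq_top adjoin_eq_top ?_
  rintro _ ((⟨i, rfl⟩ | ⟨i, rfl⟩) | rfl)
  exacts [hx i, hy i, hv]

theorem range_algHom_le {P : B k →ₐ[k] R} {L : Subalgebra k R} (hx : ∀ i, P (x k i) ∈ L)
    (hy : ∀ i, P (y k i) ∈ L) (hv : P (v k) ∈ L) : P.range ≤ L := by
  rw [← Algebra.map_top, ← adjoin_eq_top, Subalgebra.map_le, Algebra.adjoin_le_iff]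
  rintro _ ((⟨i, rfl⟩ | ⟨i, rfl⟩) | rfl)
  exacts [hx i, hy i, hv]

theorem comp_point (g : R →ₐ[k] S) (ξ η : Fin 3 → R) (ν : R) :
    g.comp (point ξ η ν) = point (k := k) (g ∘ ξ) (g ∘ η) (g ν) := by
  apply algHom_ext <;> simp

end Points

section Flow

variable {k R S : Type*} [Field k] [CommRing R] [Algebra k R] [CommRing S] [Algebra k S]
  (a b : ℕ)

/-- The restriction of `(y₁y₂y₃)^b` to the parametrised line `T ↦ η + Tω`. -/
def restrictToLine (η ω : Fin 3 → R) : R[X] := ∏ j, (C (η j) + C (ω j) * X) ^ b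

theorem map_restrictToLine (g : R →+* S) (η ω : Fin 3 → R) :
    (restrictToLine b η ω).map g = restrictToLine b (g ∘ η) (g ∘ ω) := by
  simp [restrictToLine, Polynomial.map_prod]

theorem restrictToLine_comp (η ω : Fin 3 → R) (c : R) :
    (restrictToLine b η ω).comp (C 0 + C c * X) = restrictToLine b η (c • ω) := by
  simp [restrictToLine, prod_comp, mul_left_comm, mul_assoc, mul_comm c]

theorem eval_antiderivative_restrictToLine_map (g : R →ₐ[k] S) (η ω : Fin 3 → R) (t : R) :
    (antiderivative k (restrictToLine b (g ∘ η) (g ∘ ω))).eval (g t) =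
      g ((antiderivative k (restrictToLine b η ω)).eval t) := by
  rw [← RingHom.coe_coe g, ← map_restrictToLine, ← map_antiderivative, eval_map_apply]

/-- The action `exp (T D)` of the additive group on `B`. -/
def flow : B k →ₐ[k] (B k)[X] :=
  point (fun i => C (x k i)) (fun i => C (y k i) + C (x k i ^ a) * X)
    (C (v k) + antiderivative k (restrictToLine b (y k) (x k ^ a)))

theorem orbitPoint_flow_point (ξ η : Fin 3 → R) (ν t : R) :
    orbitPoint (flow a b) (point ξ η ν) t = point (k := k) ξ (η + t • ξ ^ a)
      (ν + (antiderivative k (restrictToLine b η (ξ ^ a))).eval t) := by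
  have hx : point (k := k) ξ η ν ∘ (x k ^ a) = ξ ^ a := by
    ext i
    simp
  have hy : point (k := k) ξ η ν ∘ y k = η := by
    ext i
    simp
  apply algHom_ext
  · simp [orbitPoint_apply, flow]
  · simp [orbitPoint_apply, flow, eval₂_pow, mul_comm]
  · simp [orbitPoint_apply, flow, eval₂_eq_eval_map, map_antiderivative, map_restrictToLine, hx, hy]

variable [CharZero k]

theorem mul_eval_antiderivative_restrictToLine (η ω : Fin 3 → R) (c t : R) :
    c * (antiderivative k (restrictToLine b η (c • ω))).eval t =
      (antiderivative k (restrictToLine b η ω)).eval (c * t) := by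
  have h := congrArg (eval t) (C_mul_antiderivative_comp k (restrictToLine b η ω) c 0)
  rw [restrictToLine_comp] at h
  simpa [eval_comp, eval_zero_antiderivative] using h

theorem isExponential_flow : IsExponential (D k a b) (flow (k := k) a b) := by
  refine .of_adjoin_eq_top adjoin_eq_top ?_ ?_
  · rintro _ ((⟨i, rfl⟩ | ⟨i, rfl⟩) | rfl)
    · simp [flow]
    · simp [flow]
    · simp [flow, eval_zero_antiderivative]
  · rintro _ ((⟨i, rfl⟩ | ⟨i, rfl⟩) | rfl)
    · simp [flow, D_x]
    · simp [flow, D_y]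
    · simp [flow, D_v, derivative_antiderivative, restrictToLine, Finset.prod_pow]

end Flow

section ZeroLocus

variable {k : Type*} [Field k]

theorem sub_point_zero_y_v_mem_xIdeal (f : B k) : f - point 0 (y k) (v k) f ∈ xIdeal k := by
  rw [← Ideal.Quotient.mk_eq_mk_iff_sub_mem]
  have h : Ideal.Quotient.mkₐ k (xIdeal k) =
      (Ideal.Quotient.mkₐ k (xIdeal k)).comp (point 0 (y k) (v k)) := by
    apply algHom_ext
    · intro i
      have hi : x k i ∈ xIdeal k := Ideal.subset_span (Set.mem_range_self i)
      simpa [Ideal.Quotient.eq_zero_iff_mem] using hi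
    · simp
    · simp
  exact DFunLike.congr_fun h f

theorem disjoint_one_xIdeal :
    Disjoint (1 : Submodule k (B k)) ((xIdeal k).restrictScalars k) := by
  rw [Submodule.disjoint_def]
  rintro f hf hfx
  obtain ⟨c, rfl⟩ := Submodule.mem_one.1 hf
  have hle : xIdeal k ≤ RingHom.ker (point (0 : Fin 3 → k) 0 0 : B k →ₐ[k] k) := by
    rw [xIdeal, Ideal.span_le]
    rintro _ ⟨i, rfl⟩
    exact point_x 0 0 0 i
  have hc : c = 0 := by
    simpa using hle hfx
  rw [hc, map_zero]

variable {K : Type*} [CharZero k] [Field K] [Algebra k K] {a b : ℕ}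

theorem orbitPoint_flow_point_of_eval_eq_zero {ξ η ω : Fin 3 → K} {c t : K} (hc : c ≠ 0)
    (hξ : ξ ^ a = c • ω) (ht : (antiderivative k (restrictToLine b η ω)).eval t = 0) (ν : K) :
    orbitPoint (flow a b) (point ξ η ν) (t / c) = point (k := k) ξ (η + t • ω) ν := by
  have hv := mul_eval_antiderivative_restrictToLine (k := k) b η ω c (t / c)
  rw [mul_div_cancel₀ _ hc, ht] at hv
  rw [orbitPoint_flow_point, hξ, (mul_eq_zero.1 hv).resolve_left hc, smul_smul,
    div_mul_cancel₀ _ hc, add_zero]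

/-- Over `K(X)` the orbit of `(ξ X, η, ν)`, where `ξ ^ a = ω`, at time `t / X ^ a` is
`(ξ X, η + t ω, ν)`; both points are defined over `K[X]` and can be specialised to `X = 0`. -/
theorem point_zero_add_smul_apply [IsAlgClosed K] (ha : a ≠ 0) {f : B k}
    (hf : f ∈ (D k a b).kernel) (η ω : Fin 3 → K) (ν : K) {t : K}
    (ht : (antiderivative k (restrictToLine b η ω)).eval t = 0) :
    point 0 (η + t • ω) ν f = point 0 η ν f := by
  choose ξ hξ using fun i => IsAlgClosed.exists_pow_nat_eq (ω i) (Nat.pos_of_ne_zero ha)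
  let P (η : Fin 3 → K) : B k →ₐ[k] K[X] := point (fun i => C (ξ i) * X) (C ∘ η) (C ν)
  let ι : K[X] →ₐ[k] FractionRing K[X] := IsScalarTower.toAlgHom k _ _
  let κ : K →ₐ[k] FractionRing K[X] := IsScalarTower.toAlgHom k _ _
  have hκ (c : K) : ι (C c) = κ c := (IsScalarTower.algebraMap_apply K K[X] _ c).symm
  have hι : Function.Injective ι := IsFractionRing.injective K[X] (FractionRing K[X])
  have hP (η : Fin 3 → K) : ι.comp (P η) = point (fun i => κ (ξ i) * ι X) (κ ∘ η) (κ ν) := by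
    apply algHom_ext <;> simp [P, hκ]
  have hmove : orbitPoint (flow a b) (ι.comp (P η)) (κ t / ι X ^ a) =
      ι.comp (P (η + t • ω)) := by
    rw [hP, hP, orbitPoint_flow_point_of_eval_eq_zero (ω := κ ∘ ω)]
    · congr
      ext i
      simp
    · exact pow_ne_zero _ ((map_ne_zero_iff ι hι).2 X_ne_zero)
    · ext i
      simp [mul_pow, ← hξ, mul_comm]
    · rw [eval_antiderivative_restrictToLine_map, ht, map_zero]
  have hconst : P (η + t • ω) f = P η f := by
    apply hι
    rw [← AlgHom.comp_apply, ← hmove, (isExponential_flow a b).orbitPoint_eq _ _ hf,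
      AlgHom.comp_apply]
  have hspecialise (η : Fin 3 → K) :
      ((aeval 0 : K[X] →ₐ[K] K).restrictScalars k).comp (P η) = point 0 η ν := by
    apply algHom_ext <;> simp [P]
  rw [← hspecialise, AlgHom.comp_apply, hconst, ← AlgHom.comp_apply, hspecialise]

theorem point_zero_apply_of_eq_zero [IsAlgClosed K] (ha : a ≠ 0) (hb : b ≠ 0) {f : B k}
    (hf : f ∈ (D k a b).kernel) {η : Fin 3 → K} (hη : ∃ i, η i = 0) (ν : K) :
    point 0 η ν f = point 0 0 ν f := by
  obtain ⟨i, hi⟩ := hη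
  have hline : restrictToLine b 0 η = 0 :=
    Finset.prod_eq_zero (Finset.mem_univ i) (by simp [hi, hb])
  simpa using point_zero_add_smul_apply ha hf 0 η ν (t := 1) (by simp [hline])

/-- A general `η` lies on a line through a point of the plane `y₁ = 0` along which `(y₁y₂y₃)^b` is a
multiple of `X ^ (2 * b) * (X - 1) ^ b`. -/
theorem point_zero_apply [IsAlgClosed K] (ha : a ≠ 0) (hb : b ≠ 0) {f : B k}
    (hf : f ∈ (D k a b).kernel) (η : Fin 3 → K) (ν : K) :
    point 0 η ν f = point 0 0 ν f := by
  obtain ⟨t, ht₀, ht₁, ht⟩ := exists_isRoot_antiderivative k (K := K) (2 * b) hb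
  let base : Fin 3 → K := ![0, η 1 / (1 - t), 0]
  let direction : Fin 3 → K := ![η 0 / t, -(η 1 / (1 - t)), η 2 / t]
  have hline : restrictToLine b base direction =
      C ((η 0 / t * -(η 1 / (1 - t)) * (η 2 / t)) ^ b) * (X ^ (2 * b) * (X - 1) ^ b) := by
    simp only [restrictToLine, base, direction, Fin.prod_univ_three, pow_mul, ← mul_pow, map_pow]
    congr 1
    simp only [Matrix.cons_val_zero, Matrix.cons_val_one, Matrix.cons_val, map_zero, map_neg,
      map_mul]
    ring
  have hend : base + t • direction = η := by
    have ht₁' : 1 - t ≠ 0 := sub_ne_zero.2 ht₁.symm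
    funext i
    fin_cases i <;> simp [base, direction] <;> field_simp
    ring
  calc point 0 η ν f = point 0 (base + t • direction) ν f := by rw [hend]
    _ = point 0 base ν f := point_zero_add_smul_apply ha hf base direction ν <| by
      rw [hline, ← smul_eq_C_mul, map_smul, eval_smul, ht, smul_zero]
    _ = point 0 0 ν f := point_zero_apply_of_eq_zero ha hb hf ⟨0, rfl⟩ ν

theorem point_zero_one_apply {f : B k} (hf : f ∈ (D k a b).kernel) (ha : a ≠ 0) (ν : K) :
    point 0 1 ν f = point 0 1 0 f := by
  have horbit : orbitPoint (flow a b) (point 0 1 ν) (-ν) = point (k := k) (R := K) 0 1 0 := by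
    simp [orbitPoint_flow_point, restrictToLine, antiderivative_one, ha]
  rw [← horbit, (isExponential_flow a b).orbitPoint_eq _ _ hf]

theorem point_zero_apply_eq_apply_zero (ha : a ≠ 0) (hb : b ≠ 0) {f : B k}
    (hf : f ∈ (D k a b).kernel) (η : Fin 3 → k) (ν : k) :
    point 0 η ν f = point 0 0 0 f := by
  let ι : k →ₐ[k] AlgebraicClosure k := Algebra.ofId k _
  have hι (η : Fin 3 → k) (ν : k) : ι (point 0 η ν f) = point 0 (ι ∘ η) (ι ν) f := by
    have hzero : ι ∘ (0 : Fin 3 → k) = 0 := by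
      ext
      simp
    rw [← AlgHom.comp_apply, comp_point, hzero]
  apply (algebraMap k (AlgebraicClosure k)).injective
  change ι _ = ι _
  rw [hι, hι, point_zero_apply ha hb hf, ← point_zero_apply ha hb hf 1,
    point_zero_one_apply hf ha, point_zero_apply ha hb hf, ← point_zero_apply ha hb hf (ι ∘ 0),
    map_zero]

theorem point_zero_y_v_apply (ha : a ≠ 0) (hb : b ≠ 0) {f : B k} (hf : f ∈ (D k a b).kernel) :
    point 0 (y k) (v k) f = algebraMap k (B k) (point 0 0 0 f) := by
  refine MvPolynomial.funext fun p => ?_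
  have hcomp : (MvPolynomial.aeval p : B k →ₐ[k] k).comp (point 0 (y k) (v k)) =
      point 0 (fun i => p (Sum.inr (Sum.inl i))) (p (Sum.inr (Sum.inr ()))) := by
    apply algHom_ext
    · simp
    · intro i
      rw [AlgHom.comp_apply, point_y, point_y, y, MvPolynomial.aeval_X]
    · rw [AlgHom.comp_apply, point_v, point_v, v, MvPolynomial.aeval_X]
  rw [← MvPolynomial.aeval_eq_eval, ← AlgHom.comp_apply, hcomp,
    point_zero_apply_eq_apply_zero ha hb hf, AlgHom.commutes, Algebra.algebraMap_self_apply]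

theorem kernel_le_one_sup_xIdeal (ha : a ≠ 0) (hb : b ≠ 0) :
    Subalgebra.toSubmodule (D k a b).kernel ≤
      (1 : Submodule k (B k)) ⊔ (xIdeal k).restrictScalars k := by
  intro f hf
  rw [← add_sub_cancel (point 0 (y k) (v k) f) f]
  refine Submodule.add_mem_sup ?_ (sub_point_zero_y_v_mem_xIdeal f)
  rw [point_zero_y_v_apply ha hb hf]
  exact Submodule.algebraMap_mem _

end ZeroLocus

section Slice

variable {k R S : Type*} [Field k] [CommRing R] [Algebra k R] [CommRing S] [Algebra k S]
  (a b : ℕ)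

/-- The polynomial `ω i ^ (2 * b) * (y₁y₂y₃)^b` along the line `T ↦ η + Tω`, as a polynomial in the
coordinate `X = η i + T ω i` of the line, in which it needs no denominators. -/
def clearedLine (η ω : Fin 3 → R) (i : Fin 3) : R[X] :=
  X ^ b * ∏ j ∈ Finset.univ.erase i, (C (ω i * η j - ω j * η i) + C (ω j) * X) ^ b

theorem map_clearedLine (g : R →+* S) (η ω : Fin 3 → R) (i : Fin 3) :
    (clearedLine b η ω i).map g = clearedLine b (g ∘ η) (g ∘ ω) i := by
  simp [clearedLine, Polynomial.map_prod]

theorem clearedLine_add_smul (η ω : Fin 3 → R) (t : R) (i : Fin 3) :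
    clearedLine b (η + t • ω) ω i = clearedLine b η ω i := by
  have hcross (j : Fin 3) : ω i * (η + t • ω) j - ω j * (η + t • ω) i =
      ω i * η j - ω j * η i := by
    simp only [Pi.add_apply, Pi.smul_apply, smul_eq_mul]
    ring
  simp only [clearedLine, hcross]

theorem clearedLine_comp (η ω : Fin 3 → R) (i : Fin 3) :
    (clearedLine b η ω i).comp (C (η i) + C (ω i) * X) =
      C (ω i ^ (2 * b)) * restrictToLine b η ω := by
  have hfactor (j : Fin 3) : C (ω i * η j - ω j * η i) + C (ω j) * (C (η i) + C (ω i) * X) =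
      C (ω i) * (C (η j) + C (ω j) * X) := by
    simp only [map_sub, map_mul]
    ring
  have hcard : (Finset.univ.erase i).card = 2 := by simp
  rw [restrictToLine, ← Finset.mul_prod_erase _ _ (Finset.mem_univ i)]
  simp only [clearedLine, mul_comp, prod_comp, pow_comp, add_comp, C_comp, X_comp, hfactor, mul_pow,
    Finset.prod_mul_distrib, Finset.prod_const, hcard, map_pow]
  ring

variable [CharZero k]

theorem C_pow_mul_antiderivative_restrictToLine (η ω : Fin 3 → R) (i : Fin 3) :
    C (ω i ^ (2 * b + 1)) * antiderivative k (restrictToLine b η ω) =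
      (antiderivative k (clearedLine b η ω i)).comp (C (η i) + C (ω i) * X) -
        C ((antiderivative k (clearedLine b η ω i)).eval (η i)) := by
  rw [← C_mul_antiderivative_comp, clearedLine_comp, ← smul_eq_C_mul, ← smul_eq_C_mul,
    ← smul_eq_C_mul, map_smul, smul_smul, pow_succ']

end Slice

section Invariants

variable (k : Type*) [Field k] (a b : ℕ)

/-- The element `hᵢ`, written as a polynomial. -/
def hPoly (i : Fin 3) : B k :=
  x k i ^ ((2 * b + 1) * a) * v k -
    (antiderivative k (clearedLine b (y k) (x k ^ a) i)).eval (y k i)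

variable {k} [CharZero k]

theorem C_pow_mul_flow_v (i : Fin 3) :
    C (x k i ^ ((2 * b + 1) * a)) * flow a b (v k) = C (hPoly k a b i) +
      (antiderivative k (clearedLine b (y k) (x k ^ a) i)).comp
        (C (y k i) + C (x k i ^ a) * X) := by
  have h := C_pow_mul_antiderivative_restrictToLine (k := k) b (y k) (x k ^ a) i
  rw [Pi.pow_apply, ← pow_mul'] at h
  rw [flow, point_v, mul_add, h, hPoly, map_sub, map_mul]
  ring

theorem hPoly_mem_kernel (i : Fin 3) : hPoly k a b i ∈ (D k a b).kernel := by
  rw [(isExponential_flow a b).mem_kernel_iff]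
  let p := antiderivative k (clearedLine b (y k) (x k ^ a) i)
  have hx : flow a b ∘ (x k ^ a) = C ∘ (x k ^ a) := by
    ext j : 1
    simp [flow]
  have hy : flow a b ∘ y k = C ∘ y k + (X : (B k)[X]) • (C ∘ (x k ^ a)) := by
    ext j : 1
    simp [flow, mul_comm X]
  have hmap : p.map (flow (k := k) a b : B k →+* (B k)[X]) = p.map C := by
    have hC : (C : B k →+* (B k)[X]) = (CAlgHom (R := k) : B k →ₐ[k] (B k)[X]) := rfl
    rw [hC, map_antiderivative, map_antiderivative, map_clearedLine, map_clearedLine,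
      RingHom.coe_coe, hy, hx, clearedLine_add_smul]
    rfl
  have heval : flow a b (p.eval (y k i)) = p.comp (C (y k i) + C (x k i ^ a) * X) := by
    rw [comp, ← eval_map, ← hmap]
    rw [← RingHom.coe_coe (flow a b), ← eval_map_apply]
    simp [flow]
  rw [hPoly, map_sub, heval, map_mul, sub_eq_iff_eq_add, ← hPoly, ← C_pow_mul_flow_v]
  simp [flow]

theorem algebraMap_hPoly (i : Fin 3) :
    algebraMap (B k) (FractionRing (B k)) (hPoly k a b i) = hFrac k a b i := by
  let ι := algebraMap (B k) (FractionRing (B k))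
  have hx : ι (x k i) ^ a ≠ 0 :=
    pow_ne_zero _ ((map_ne_zero_iff ι (IsFractionRing.injective _ _)).2 (MvPolynomial.X_ne_zero _))
  have hslice : aeval (-ι (y k i) / ι (x k i) ^ a) (C (y k i) + C (x k i ^ a) * X) = 0 := by
    simp [ι, mul_div_cancel₀ _ hx]
  have h := congrArg (aeval (-ι (y k i) / ι (x k i) ^ a)) (C_pow_mul_flow_v (k := k) a b i)
  rw [map_add, aeval_comp, hslice, ← coeff_zero_eq_aeval_zero', coeff_zero_antiderivative, map_zero,
    add_zero, map_mul, aeval_C, aeval_C, map_pow] at h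
  rw [hFrac, (isExponential_flow a b).theta_eq, ← h]

end Invariants

section Algebra

variable {k : Type*} [Field k] (a b : ℕ)

theorem x_mem_A (h : Fin 3 → B k) (i : Fin 3) : x k i ∈ A k a h := by
  apply Algebra.subset_adjoin
  fin_cases i <;> simp

theorem h_mem_A (h : Fin 3 → B k) (i : Fin 3) : h i ∈ A k a h := by
  apply Algebra.subset_adjoin
  fin_cases i <;> simp

theorem cross_mem_A (h : Fin 3 → B k) (i j : Fin 3) :
    x k i ^ a * y k j - x k j ^ a * y k i ∈ A k a h := by
  have hlt : ∀ i j : Fin 3, i < j → x k i ^ a * y k j - x k j ^ a * y k i ∈ A k a h := by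
    intro i j hij
    apply Algebra.subset_adjoin
    fin_cases i <;> fin_cases j <;> simp at hij ⊢
  rcases lt_trichotomy i j with hij | rfl | hji
  · exact hlt i j hij
  · simp
  · rw [← neg_sub]
    exact neg_mem (hlt j i hji)

theorem xIdealA_eq_span_range (h : Fin 3 → B k) :
    xIdealA k a h = Ideal.span (Set.range fun i => (⟨x k i, x_mem_A a h i⟩ : A k a h)) := by
  rw [xIdealA]
  congr 1
  ext g
  simp only [Set.mem_ofPred_eq, Set.mem_range, Subtype.ext_iff, eq_comm]

theorem x_ne_zero (i : Fin 3) : x k i ≠ 0 := MvPolynomial.X_ne_zero _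

theorem not_x_zero_dvd_x_one : ¬ x k 0 ∣ x k 1 := by
  intro hdvd
  simpa using map_dvd (point (Pi.single 1 1) 0 0 : B k →ₐ[k] k) hdvd

theorem cross_mem_kernel (i j : Fin 3) :
    x k i ^ a * y k j - x k j ^ a * y k i ∈ (D k a b).kernel := by
  change D k a b _ = 0
  rw [map_sub, Derivation.leibniz, Derivation.leibniz, Derivation.leibniz_pow,
    Derivation.leibniz_pow, D_x, D_x, D_y, D_y]
  simp only [smul_eq_mul, mul_zero, smul_zero, add_zero]
  exact sub_eq_zero.2 (mul_comm _ _)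

variable [CharZero k]

theorem A_le_kernel : A k a (hPoly k a b) ≤ (D k a b).kernel := by
  rw [A, Algebra.adjoin_le_iff]
  rintro f (rfl | rfl | rfl | rfl | rfl | rfl | rfl | rfl | rfl)
  exacts [D_x a b _, D_x a b _, D_x a b _, cross_mem_kernel a b _ _, cross_mem_kernel a b _ _,
    cross_mem_kernel a b _ _, hPoly_mem_kernel a b _, hPoly_mem_kernel a b _,
    hPoly_mem_kernel a b _]

/-- An invariant is its own value at the point where the orbit meets the slice `yᵢ = 0`, and the
coordinates of that point lie in `A[1/xᵢ]`. -/
theorem algebraMap_mem_localizationAway {f : B k} (hf : f ∈ (D k a b).kernel) (i : Fin 3) :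
    algebraMap (B k) (FractionRing (B k)) f ∈
      localizationAway (A k a (hPoly k a b)) ⟨x k i, x_mem_A a _ i⟩ := by
  let ι : B k →ₐ[k] FractionRing (B k) := IsScalarTower.toAlgHom k _ _
  let P : B k →ₐ[k] FractionRing (B k) := orbitPoint (flow a b) ι (-ι (y k i) / ι (x k i) ^ a)
  have hx : algebraMap (B k) (FractionRing (B k)) (x k i) ≠ 0 :=
    (map_ne_zero_iff _ (IsFractionRing.injective _ _)).2 (x_ne_zero i)
  have hP : P.range ≤ localizationAway (A k a (hPoly k a b)) ⟨x k i, x_mem_A a _ i⟩ := by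
    apply range_algHom_le
    · intro j
      refine ⟨0, x k j, x_mem_A a _ j, ?_⟩
      simp [P, orbitPoint_apply, flow, ι]
    · intro j
      refine ⟨a, _, cross_mem_A a _ i j, ?_⟩
      have hPy : P (y k j) = ι (y k j) + ι (x k j) ^ a * (-ι (y k i) / ι (x k i) ^ a) := by
        simp [P, orbitPoint_apply, flow, ι, eval₂_pow]
      have hι (g : B k) : algebraMap (B k) (FractionRing (B k)) g = ι g := rfl
      rw [hι] at hx
      rw [hPy, hι, hι, map_sub, map_mul, map_mul, map_pow, map_pow]
      field_simp
      ring
    · refine ⟨(2 * b + 1) * a, hPoly k a b i, h_mem_A a _ i, ?_⟩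
      rw [algebraMap_hPoly, hFrac, (isExponential_flow a b).theta_eq]
      rfl
  exact hP ⟨f, (isExponential_flow a b).orbitPoint_eq ι _ hf⟩

theorem map_kernel_eq_iInf_localizationAway :
    (D k a b).kernel.map (IsScalarTower.toAlgHom k (B k) (FractionRing (B k))) =
      ⨅ i, localizationAway (A k a (hPoly k a b)) ⟨x k i, x_mem_A a _ i⟩ := by
  apply le_antisymm
  · rw [Subalgebra.map_le]
    exact fun f hf => Algebra.mem_iInf.2 fun i => algebraMap_mem_localizationAway a b hf i
  · intro q hq
    rw [Algebra.mem_iInf] at hq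
    obtain ⟨f, rfl⟩ := mem_range_algebraMap_of_mem_localizationAway MvPolynomial.X_prime
      not_x_zero_dvd_x_one (hq 0) (hq 1)
    obtain ⟨N, hN⟩ := algebraMap_mem_localizationAway_iff.1 (hq 0)
    have hDf : x k 0 ^ N * D k a b f = 0 := by
      have h : D k a b (x k 0 ^ N * f) = 0 := A_le_kernel a b hN
      simpa [D_x, Derivation.leibniz_pow] using h
    exact ⟨f, (mul_eq_zero.1 hDf).resolve_left (pow_ne_zero N (x_ne_zero 0)), rfl⟩

theorem isSeparatingAlgebra_A (ha : a ≠ 0) (hb : b ≠ 0) :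
    IsSeparatingAlgebra (A k a (hPoly k a b)) (D k a b).kernel := by
  have hmul : ∀ f ∈ (D k a b).kernel, ∀ i, ∃ N : ℕ, x k i ^ N * f ∈ A k a (hPoly k a b) := by
    intro f hf i
    have h := algebraMap_mem_localizationAway a b hf i
    rwa [algebraMap_mem_localizationAway_iff] at h
  exact isSeparatingAlgebra_of_pow_mul_mem (A_le_kernel a b) (x_mem_A a _) hmul
    (kernel_le_one_sup_xIdeal ha hb)

theorem isRingOfRegularFunctions_A :
    IsRingOfRegularFunctions (A k a (hPoly k a b)) (D k a b).kernel
      (xIdealA k a (hPoly k a b)) := by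
  have hs (i : Fin 3) : (⟨x k i, x_mem_A a (hPoly k a b) i⟩ : A k a (hPoly k a b)) ≠ 0 :=
    Subtype.coe_ne_coe.1 (x_ne_zero i)
  rw [xIdealA_eq_span_range]
  exact isRingOfRegularFunctions_of_map_eq_iInf (A_le_kernel a b)
    hs (map_kernel_eq_iInf_localizationAway a b)

theorem image_kernel_eq_idealTransform :
    algebraMap (B k) (FractionRing (B k)) '' ((D k a b).kernel : Set (B k)) =
      idealTransform (A k a (hPoly k a b)) (xIdealA k a (hPoly k a b)) := by
  rw [xIdealA_eq_span_range, ← coe_iInf_localizationAway _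
    (fun i => Subtype.coe_ne_coe.1 (x_ne_zero i)), ← map_kernel_eq_iInf_localizationAway]
  rfl

end Algebra

end SevenDim

end

theorem lemma5p3_general {k : Type*} [Field k] [CharZero k] (a b : ℕ) (ha : 1 ≤ a) (hb : 1 ≤ b) :
    IsLND (SevenDim.D k a b) ∧
    Disjoint (1 : Submodule k (SevenDim.B k)) ((SevenDim.xIdeal k).restrictScalars k) ∧
    Subalgebra.toSubmodule (SevenDim.D k a b).kernel ≤
      (1 : Submodule k (SevenDim.B k)) ⊔ (SevenDim.xIdeal k).restrictScalars k ∧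
    ∃ h : Fin 3 → SevenDim.B k,
      (∀ i, algebraMap (SevenDim.B k) (FractionRing (SevenDim.B k)) (h i) =
        SevenDim.hFrac k a b i) ∧
      IsSeparatingAlgebra (SevenDim.A k a h) (SevenDim.D k a b).kernel ∧
      IsRingOfRegularFunctions (SevenDim.A k a h) (SevenDim.D k a b).kernel
        (SevenDim.xIdealA k a h) ∧
      algebraMap (SevenDim.B k) (FractionRing (SevenDim.B k)) ''
          ((SevenDim.D k a b).kernel : Set (SevenDim.B k)) =
        idealTransform (SevenDim.A k a h) (SevenDim.xIdealA k a h) := by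
  have ha' : a ≠ 0 := Nat.one_le_iff_ne_zero.1 ha
  have hb' : b ≠ 0 := Nat.one_le_iff_ne_zero.1 hb
  exact ⟨(SevenDim.isExponential_flow a b).isLND, SevenDim.disjoint_one_xIdeal,
    SevenDim.kernel_le_one_sup_xIdeal ha' hb', SevenDim.hPoly k a b, SevenDim.algebraMap_hPoly a b,
    SevenDim.isSeparatingAlgebra_A a b ha' hb', SevenDim.isRingOfRegularFunctions_A a b,
    SevenDim.image_kernel_eq_idealTransform a b⟩

theorem lemma5p3 {k : Type*} [Field k] [IsAlgClosed k] [CharZero k] (a b : ℕ)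
    (ha : 1 ≤ a) (hb : 1 ≤ b) :
    -- `D` is locally nilpotent, and `B^D ⊆ k ⊕ (x₁, x₂, x₃)B`
    IsLND (SevenDim.D k a b) ∧
    Disjoint (1 : Submodule k (SevenDim.B k)) ((SevenDim.xIdeal k).restrictScalars k) ∧
    Subalgebra.toSubmodule (SevenDim.D k a b).kernel ≤
      (1 : Submodule k (SevenDim.B k)) ⊔ (SevenDim.xIdeal k).restrictScalars k ∧
    -- the elements `h₁, h₂, h₃` are polynomials, and the algebra `A` has the stated properties
    ∃ h : Fin 3 → SevenDim.B k,
      (∀ i, algebraMap (SevenDim.B k) (FractionRing (SevenDim.B k)) (h i) =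
        SevenDim.hFrac k a b i) ∧
      IsSeparatingAlgebra (SevenDim.A k a h) (SevenDim.D k a b).kernel ∧
      IsRingOfRegularFunctions (SevenDim.A k a h) (SevenDim.D k a b).kernel
        (SevenDim.xIdealA k a h) ∧
      algebraMap (SevenDim.B k) (FractionRing (SevenDim.B k)) ''
          ((SevenDim.D k a b).kernel : Set (SevenDim.B k)) =
        idealTransform (SevenDim.A k a h) (SevenDim.xIdealA k a h) :=
  lemma5p3_general a b ha hb
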